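/- Let $\mathcal H$ be a separable complex Hilbert space and $\mathbb L(\mathcal H)$ the lattice of its closed subspaces, with $U\wedge V=U\cap V$ and $U\vee V=\overline{U+V}$; $P_U$ denotes the orthogonal projection onto $U$. A *Boolean sector* is a maximal distributive sublattice $\mathbb B\subseteq\mathbb L(\mathcal H)$ (sublattices contain $0$ and $\mathcal H$) that is closed under $U\mapsto U^\perp$. A *quasipoint* of $\mathbb B$ is a maximal element $\beta$ among the non-empty subsets of $\mathbb B$ that do not contain $0$ and in which any two elements $U,V$ have some $W\in\beta$ with $W\subseteq U\cap V$. The set $\mathcal Q(\mathbb B)$ of quasipoints carries the topology with base $\{\beta : U\in\beta\}$, $U\in\mathbb B$. Let $C^*(\mathbb B)$ be the norm closure of the complex linear span of $\{P_U : U\in\mathbb B\}$. For a bounded self-adjoint operator $A$ let $\sigma_A(\lambda)$ be the range of its spectral projection for $(-\infty,\lambda]$, that is, $\sigma_A(\lambda)=\ker (A-\lambda)^+$, and for $\beta\in\mathcal Q(\mathbb B)$ put $f_A(\beta)=\inf\{\lambda\in\mathbb R : \sigma_A(\lambda)\in\beta\}$. Let $\mathbb B$ be a Boolean sector and $\rho$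 a state, i.e. a positive bounded operator on $\mathcal H$ with trace $1$. Then for every $\varphi\in C(\mathcal Q(\mathbb B),\mathbb C)$ there is a unique operator of the form $A_\varphi=A_1+iA_2$ with self-adjoint $A_1,A_2\in C^*(\mathbb B)$, $f_{A_1}=\operatorname{Re}\varphi$ and $f_{A_2}=\operatorname{Im}\varphi$, and $\rho A_\varphi$ has a trace (the sum $\sum_i\langle \rho A_\varphi e_i,e_i\rangle$ converges unconditionally, to the same value for every orthonormal basis). Let $\mu_\rho^{\mathbb B}$ be the Radon measure on $\mathcal Q(\mathbb B)$ given, as a functional on $C(\mathcal Q(\mathbb B),\mathbb C)$, by $\varphi\mapsto \operatorname{tr}(\rho A_\varphi)$. For every $\beta_0\in\mathcal Q(\mathbb B)$, $\mu_\rho^{\mathbb B}$ is the point measure $\varepsilon_{\beta_0}:\varphi\mapsto\varphi(\beta_0)$ if and only if there is a unit vector $x\in\mathcal H$ such that $\mathbb Cx\in\mathbb B$, $\beta_0=\beta_{\mathbb Cx}:=\{U\in\mathbb B : \mathbb Cx\subseteq U\}$ and $\rho=P_{\mathbb Cx}$. -/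

import Mathlib

open scoped InnerProductSpace

universe u

namespace QuantumLattice

noncomputable section

/-! ### Quasipoints and the Stonean space of a lattice -/

/-- A filter basis in a lattice `L`: a non-empty subset that does not contain the least element
of `L`, and any two elements of which have a lower bound in the subset. -/
structure IsFilterBasis {L : Type*} [Lattice L] (F : Set L) : Prop where
  nonempty : F.Nonempty
  not_isBot : ∀ a ∈ F, ¬ IsBot a
  exists_le_inf : ∀ a ∈ F, ∀ b ∈ F, ∃ c ∈ F, c ≤ a ⊓ b

/-- The set `Q(L)` of quasipoints (maximal filter bases) of a lattice `L`. -/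
def Quasipoint (L : Type*) [Lattice L] : Type _ :=
  {β : Set L // Maximal IsFilterBasis β}

/-- The basic open set `Q_a(L)` of all quasipoints that contain `a`. -/
def Quasipoint.basicOpen {L : Type*} [Lattice L] (a : L) : Set (Quasipoint L) :=
  {β | a ∈ β.1}

/-- The Stonean topology on `Q(L)`: the sets `Q_a(L)` form a base. -/
instance Quasipoint.instTopologicalSpace (L : Type*) [Lattice L] :
    TopologicalSpace (Quasipoint L) :=
  TopologicalSpace.generateFrom (Set.range Quasipoint.basicOpen)

/-! ### Boolean sectors of the lattice of closed subspaces -/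

variable {H : Type u} [NormedAddCommGroup H] [InnerProductSpace ℂ H]

/-- A distributive sublattice (with the same zero and unit) of the lattice of closed subspaces.
The lattice operations are `U ⊓ V = U ∩ V` and `U ⊔ V = closure (U + V)`. -/
structure IsDistributiveSublattice (B : Sublattice (ClosedSubmodule ℂ H)) : Prop where
  bot_mem : ⊥ ∈ B
  top_mem : ⊤ ∈ B
  inf_sup : ∀ U ∈ B, ∀ V ∈ B, ∀ W ∈ B, U ⊓ (V ⊔ W) = (U ⊓ V) ⊔ (U ⊓ W)
  sup_inf : ∀ U ∈ B, ∀ V ∈ B, ∀ W ∈ B, U ⊔ (V ⊓ W) = (U ⊔ V) ⊓ (U ⊔ W)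

/-- A Boolean sector: a maximal distributive sublattice of the lattice of closed subspaces that is
closed under orthogonal complements. -/
structure IsBooleanSector (B : Sublattice (ClosedSubmodule ℂ H)) : Prop where
  maximal : Maximal IsDistributiveSublattice B
  orthogonal_mem : ∀ U ∈ B, Uᗮ ∈ B

/-- The line `ℂx`, as a closed subspace. -/
def line (x : H) : ClosedSubmodule ℂ H :=
  ⟨Submodule.span ℂ {x}, Submodule.closed_of_finiteDimensional _⟩

/-- The set `β_{ℂx}` of all elements of `B` that contain the line `ℂx`; if `ℂx` belongs to the
Boolean sector `B` this is the atomic quasipoint defined by `ℂx`. -/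
def atomicQuasipoint (B : Sublattice (ClosedSubmodule ℂ H)) (x : H) : Set B :=
  {U | line x ≤ (U : ClosedSubmodule ℂ H)}

variable [CompleteSpace H]

/-- The orthogonal projection `P_U` onto `U`, as a bounded operator on `H`. -/
def proj (U : ClosedSubmodule ℂ H) : H →L[ℂ] H := U.toSubmodule.starProjection

/-- `C*(B)`: the norm closure of the linear span of the projections `P_U`, `U ∈ B`. -/
def cstar (B : Sublattice (ClosedSubmodule ℂ H)) : Submodule ℂ (H →L[ℂ] H) :=
  (Submodule.span ℂ (proj '' (B : Set (ClosedSubmodule ℂ H)))).topologicalClosure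

/-! ### Spectral families, observable functions, and the operator `A_φ` -/

/-- The (right-continuous) spectral family of a bounded self-adjoint operator `A`: the closed
subspace at `l`, i.e. the range of the spectral projection of `A` for `(-∞, l]`, is the kernel of
the positive part `(A - l)⁺`, formed by continuous functional calculus. -/
def spectralFamily (A : H →L[ℂ] H) (l : ℝ) : ClosedSubmodule ℂ H :=
  ⟨LinearMap.ker (cfc (fun t : ℝ => max (t - l) 0) A : H →L[ℂ] H).toLinearMap,
    ContinuousLinearMap.isClosed_ker _⟩

/-- The observable function induced on `Q(B)` by a bounded self-adjoint operator `A`: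
`f_A(β) = inf {l | σ_A(l) ∈ β}`, where `σ_A` is the spectral family of `A`. -/
def observableFunction (B : Sublattice (ClosedSubmodule ℂ H)) (A : H →L[ℂ] H)
    (β : Quasipoint B) : ℝ :=
  sInf {l : ℝ | ∃ U ∈ β.1, (U : ClosedSubmodule ℂ H) = spectralFamily A l}

/-- `A = A₁ + i A₂` with self-adjoint `A₁, A₂ ∈ C*(B)` whose induced observable functions are
the real and the imaginary part of `φ`. -/
def IsOperatorOf (B : Sublattice (ClosedSubmodule ℂ H)) (φ : C(Quasipoint B, ℂ))
    (A : H →L[ℂ] H) : Prop :=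
  ∃ A₁ A₂ : H →L[ℂ] H, A₁ ∈ cstar B ∧ A₂ ∈ cstar B ∧ IsSelfAdjoint A₁ ∧ IsSelfAdjoint A₂ ∧
    A = A₁ + Complex.I • A₂ ∧
    (∀ β, observableFunction B A₁ β = (φ β).re) ∧ ∀ β, observableFunction B A₂ β = (φ β).im

/-- The operator `A_φ` in `C*(B)` that corresponds to the continuous function `φ` on `Q(B)`. -/
def operatorOf (B : Sublattice (ClosedSubmodule ℂ H)) (φ : C(Quasipoint B, ℂ)) : H →L[ℂ] H :=
  Classical.epsilon (IsOperatorOf B φ)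

/-! ### Trace, density operators, and the measure of a state -/

/-- `T` has trace `t`: for every orthonormal basis `(e_i)`, the sum of the `⟨e_i, T e_i⟩`
converges unconditionally to `t`. -/
def HasTrace (T : H →L[ℂ] H) (t : ℂ) : Prop :=
  ∀ (ι : Type u) (e : HilbertBasis ι ℂ H), HasSum (fun i => ⟪e i, T (e i)⟫_ℂ) t

open Classical in
/-- The trace of `T` (zero if `T` has no trace). -/
def trace (T : H →L[ℂ] H) : ℂ := if h : ∃ t, HasTrace T t then h.choose else 0

/-- A state: a positive operator of trace one. -/
structure IsDensityOperator (ρ : H →L[ℂ] H) : Prop where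
  isPositive : ρ.IsPositive
  hasTrace : HasTrace ρ 1

/-- The Radon measure `φ ↦ tr (ρ A_φ)` on `Q(B)`, as a functional on the continuous functions. -/
def stateMeasure (B : Sublattice (ClosedSubmodule ℂ H)) (ρ : H →L[ℂ] H)
    (φ : C(Quasipoint B, ℂ)) : ℂ :=
  trace (ρ * operatorOf B φ)

/-- The point measure `ε_β` on `Q(B)`, as a functional on the continuous functions. -/
def pointMeasure {B : Sublattice (ClosedSubmodule ℂ H)} (β : Quasipoint B)
    (φ : C(Quasipoint B, ℂ)) : ℂ :=
  φ β

end

end QuantumLattice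

/-!
# Point measures of states on the Stonean space of a Boolean sector

In a Boolean sector `B` any two projections commute (distributivity applied to `V`, `U` and `Uᗮ`),
and by maximality `B` contains every closed subspace whose projection commutes with all of `B`
(`IsBooleanSector.mem_of_commute`). Hence `B` contains the spectral subspaces of the operators in
`C*(B)`, and the quasipoints of `B` are the ultrafilters of a Boolean algebra.

A quasipoint `β` assigns to an operator `A` the scalar `c` for which `A - c` is small on small
elements of `β` (`HasValueAt`). This value is unique and linear in `A`, and for a self-adjoint
`A ∈ C*(B)` it is the observable function of `A`, because the spectral subspace `σ_A(l)` belongs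
to `β` for `l` above the value and does not for `l` below it. If all values of `A` lie in
`[-r, r]`, the spectral subspaces beyond these bounds belong to all quasipoints or to none, so they
are trivial and `‖A‖ ≤ r` (`norm_le_of_abs_value_le`). Thus `A` is determined by its observable
function, and the observable functions form a closed subspace of `C(Q(B), ℝ)`. It contains the
indicator functions of the basic clopen sets, which are the observable functions of the projections
`P_U`, and these span a point-separating algebra; since `Q(B)` is compact, the Stone–Weierstrass
theorem yields the existence of `A_φ`.

The trace of `ρ A` exists since `ρ = S * S` with `S` Hilbert–Schmidt, and it equals the trace of
`S A S` (`exists_hasTrace_of_mul_self`).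

If the measure of `ρ` is the point measure at `β₀`, then `tr (ρ P_Uᗮ) = 0` for `U ∈ β₀`, so that
`S P_Uᗮ = 0` and the range of `ρ` lies in `U`. A unit vector `x` in this range lies in every element
of `β₀`, so each projection of `B` fixes or kills `x`. Therefore `ℂx ∈ B`, and since `ℂx` is not
disjoint from the elements of `β₀`, it belongs to `β₀`. It follows that `β₀` is the atomic quasipoint
of `ℂx`, and that `ρ` has its range in `ℂx`, so that `ρ` is the projection onto `ℂx`. Conversely,
`x` is an eigenvector of `A_φ` for the eigenvalue `φ(β_{ℂx})`.
-/

namespace QuantumLattice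

/-! ### Quasipoints of a lattice -/

section Lattice

variable {L : Type*} [Lattice L]

/-- Every filter basis is contained in a quasipoint, by Zorn's lemma. -/
theorem IsFilterBasis.exists_quasipoint {F : Set L} (hF : IsFilterBasis F) :
    ∃ β : Quasipoint L, F ⊆ β.1 := by
  obtain ⟨m, hFm, hm⟩ := zorn_subset_nonempty {F : Set L | IsFilterBasis F} (by
    intro c hc hchain hne
    refine ⟨⋃₀ c, ⟨?_, ?_, ?_⟩, fun s hs => Set.subset_sUnion_of_mem hs⟩
    · obtain ⟨s, hs⟩ := hne
      exact (hc hs).nonempty.mono (Set.subset_sUnion_of_mem hs)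
    · rintro a ⟨s, hs, ha⟩
      exact (hc hs).not_isBot a ha
    · rintro a ⟨s, hs, ha⟩ b ⟨t, ht, hb⟩
      rcases hchain.total hs ht with h | h
      · obtain ⟨d, hd, hle⟩ := (hc ht).exists_le_inf a (h ha) b hb
        exact ⟨d, ⟨t, ht, hd⟩, hle⟩
      · obtain ⟨d, hd, hle⟩ := (hc hs).exists_le_inf a ha b (h hb)
        exact ⟨d, ⟨s, hs, hd⟩, hle⟩) F hF
  exact ⟨⟨m, hm⟩, hFm⟩

theorem exists_quasipoint_mem {a : L} (ha : ¬ IsBot a) : ∃ β : Quasipoint L, a ∈ β.1 := by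
  obtain ⟨β, hβ⟩ := IsFilterBasis.exists_quasipoint (F := {a})
    ⟨Set.singleton_nonempty a, by rintro _ rfl; exact ha, by
      rintro _ rfl _ rfl
      exact ⟨_, rfl, by simp⟩⟩
  exact ⟨β, hβ rfl⟩

namespace Quasipoint

variable (β : Quasipoint L) {a b : L}

/-- If `a` meets every element of a quasipoint in a non-zero element, then it belongs to the
quasipoint: the elements above some `b ⊓ a` with `b ∈ β` form a filter basis containing `β`. -/
theorem mem_of_forall_not_isBot (h : ∀ b ∈ β.1, ¬ IsBot (b ⊓ a)) : a ∈ β.1 := by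
  have hF : IsFilterBasis {d : L | ∃ b ∈ β.1, b ⊓ a ≤ d} := by
    refine ⟨?_, ?_, ?_⟩
    · obtain ⟨b, hb⟩ := β.2.prop.nonempty
      exact ⟨b, b, hb, inf_le_left⟩
    · rintro d ⟨b, hb, hle⟩ hd
      exact h b hb fun e => hle.trans (hd e)
    · rintro d ⟨b, hb, hle⟩ d' ⟨b', hb', hle'⟩
      obtain ⟨c, hc, hcle⟩ := β.2.prop.exists_le_inf b hb b' hb'
      exact ⟨c ⊓ a, ⟨c, hc, le_rfl⟩,
        le_inf ((inf_le_inf_right a (hcle.trans inf_le_left)).trans hle)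
          ((inf_le_inf_right a (hcle.trans inf_le_right)).trans hle')⟩
  obtain ⟨b, hb⟩ := β.2.prop.nonempty
  exact β.2.le_of_ge hF (fun b hb => ⟨b, hb, inf_le_left⟩) ⟨b, hb, inf_le_right⟩

variable {β}

theorem not_isBot_inf (ha : a ∈ β.1) (hb : b ∈ β.1) : ¬ IsBot (a ⊓ b) := fun h => by
  obtain ⟨c, hc, hle⟩ := β.2.prop.exists_le_inf a ha b hb
  exact β.2.prop.not_isBot c hc fun e => hle.trans (h e)

theorem mem_of_le (ha : a ∈ β.1) (hab : a ≤ b) : b ∈ β.1 :=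
  β.mem_of_forall_not_isBot fun _ hd h =>
    not_isBot_inf hd ha fun e => (inf_le_inf_left _ hab).trans (h e)

theorem inf_mem (ha : a ∈ β.1) (hb : b ∈ β.1) : a ⊓ b ∈ β.1 := by
  obtain ⟨c, hc, hle⟩ := β.2.prop.exists_le_inf a ha b hb
  exact mem_of_le hc hle

theorem inf_mem_iff : a ⊓ b ∈ β.1 ↔ a ∈ β.1 ∧ b ∈ β.1 :=
  ⟨fun h => ⟨mem_of_le h inf_le_left, mem_of_le h inf_le_right⟩, fun h => inf_mem h.1 h.2⟩

/-- In a pseudocomplemented lattice, quasipoints are ultrafilters. -/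
theorem compl_mem_iff {c : L → L} (hc : ∀ a b, IsBot (b ⊓ a) ↔ b ≤ c a) :
    c a ∈ β.1 ↔ a ∉ β.1 := by
  refine ⟨fun h ha => not_isBot_inf h ha ((hc _ _).2 le_rfl), fun h => ?_⟩
  by_contra h'
  refine h (β.mem_of_forall_not_isBot fun b hb hbot => h' ?_)
  exact mem_of_le hb ((hc _ _).1 hbot)

theorem isClopen_basicOpen {c : L → L} (hc : ∀ a b, IsBot (b ⊓ a) ↔ b ≤ c a) (a : L) :
    IsClopen (basicOpen a) := by
  have ho : ∀ a : L, IsOpen (basicOpen a) := fun a =>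
    TopologicalSpace.isOpen_generateFrom_of_mem ⟨a, rfl⟩
  refine ⟨⟨?_⟩, ho a⟩
  convert ho (c a) using 1
  ext β
  exact (compl_mem_iff hc).symm

theorem exists_mem_notMem {β γ : Quasipoint L} (h : β ≠ γ) : ∃ a ∈ β.1, a ∉ γ.1 := by
  by_contra! hsub
  exact h (Subtype.ext (Set.Subset.antisymm hsub (β.2.le_of_ge γ.2.prop hsub)))

/-- The Stonean space of a pseudocomplemented lattice is compact. If no finite part of a family `S`
gave a cover by basic open sets, the elements belonging to all quasipoints outside some finite
subcover would form a filter basis, and a quasipoint containing it would avoid `S`. -/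
theorem compactSpace {c : L → L} (hc : ∀ a b, IsBot (b ⊓ a) ↔ b ≤ c a) :
    CompactSpace (Quasipoint L) := by
  refine compactSpace_generateFrom (S := Set.range basicOpen) rfl fun P hP hcov => ?_
  by_contra! hno
  let F : Set L := {b | ∃ Q ⊆ P, Q.Finite ∧ ∀ β : Quasipoint L, β ∉ ⋃₀ Q → b ∈ β.1}
  have hcompl : ∀ a : L, basicOpen a ∈ P → c a ∈ F := fun a ha =>
    ⟨{basicOpen a}, by simpa using ha, Set.finite_singleton _, fun β hβ =>
      (compl_mem_iff hc).2 fun h => hβ ⟨_, rfl, h⟩⟩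
  have hF : IsFilterBasis F := by
    refine ⟨?_, ?_, ?_⟩
    · rcases P.eq_empty_or_nonempty with rfl | ⟨s, hs⟩
      · exact absurd hcov (hno ∅ le_rfl Set.finite_empty)
      · obtain ⟨a, rfl⟩ := hP hs
        exact ⟨c a, hcompl a hs⟩
    · rintro b ⟨Q, hQ, hfin, hb⟩ hbot
      refine hno Q hQ hfin (Set.eq_univ_of_forall fun β => ?_)
      by_contra hβ
      exact β.2.prop.not_isBot b (hb β hβ) hbot
    · rintro a ⟨Q, hQ, hfin, ha⟩ b ⟨R, hR, hfin', hb⟩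
      refine ⟨a ⊓ b, ⟨Q ∪ R, Set.union_subset hQ hR, hfin.union hfin', fun β hβ => ?_⟩, le_rfl⟩
      rw [Set.sUnion_union, Set.mem_union, not_or] at hβ
      exact inf_mem (ha β hβ.1) (hb β hβ.2)
  obtain ⟨β, hβ⟩ := hF.exists_quasipoint
  obtain ⟨s, hs, hβs⟩ : β ∈ ⋃₀ P := hcov ▸ Set.mem_univ β
  obtain ⟨a, rfl⟩ := hP hs
  exact (compl_mem_iff hc).1 (hβ (hcompl a hs)) hβs

end Quasipoint

end Lattice

section ClosedSubspaces

variable {H : Type u} [NormedAddCommGroup H] [InnerProductSpace ℂ H] [CompleteSpace H]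

/-! ### Commuting orthogonal projections -/

section Proj

variable {U V W : ClosedSubmodule ℂ H} {x : H}

theorem isSelfAdjoint_proj (U : ClosedSubmodule ℂ H) : IsSelfAdjoint (proj U) :=
  isSelfAdjoint_starProjection _

theorem proj_apply_mem (U : ClosedSubmodule ℂ H) (x : H) : proj U x ∈ U :=
  U.toSubmodule.starProjection_apply_mem x

theorem proj_apply_eq_self_iff : proj U x = x ↔ x ∈ U :=
  Submodule.starProjection_eq_self_iff

theorem proj_apply_eq_zero_iff : proj U x = 0 ↔ x ∈ Uᗮ :=
  U.toSubmodule.starProjection_apply_eq_zero_iff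

theorem proj_mul_self (U : ClosedSubmodule ℂ H) : proj U * proj U = proj U :=
  U.toSubmodule.isIdempotentElem_starProjection

theorem proj_orthogonal (U : ClosedSubmodule ℂ H) : proj Uᗮ = 1 - proj U :=
  U.toSubmodule.starProjection_orthogonal'

theorem proj_top : proj (⊤ : ClosedSubmodule ℂ H) = 1 := Submodule.starProjection_top'

theorem proj_bot : proj (⊥ : ClosedSubmodule ℂ H) = 0 := Submodule.starProjection_bot

theorem proj_injective : Function.Injective (proj (H := H)) := fun U V h => by
  refine SetLike.ext fun x => ?_
  rw [← proj_apply_eq_self_iff, ← proj_apply_eq_self_iff (U := V), h]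

/-- A self-adjoint operator commutes with the projection onto an invariant closed subspace. -/
theorem commute_proj_of_forall_mem {T : H →L[ℂ] H} (hT : IsSelfAdjoint T)
    (h : ∀ x ∈ W, T x ∈ W) : Commute T (proj W) := by
  have h1 : proj W * (T * proj W) = T * proj W := by
    ext x
    exact proj_apply_eq_self_iff.2 (h _ (proj_apply_mem W x))
  have h2 := congrArg star h1
  simp only [star_mul, hT.star_eq, (isSelfAdjoint_proj W).star_eq] at h2
  rw [Commute, SemiconjBy, ← h1, ← mul_assoc, h2]

theorem proj_inf (h : Commute (proj U) (proj V)) : proj (U ⊓ V) = proj U * proj V := by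
  ext x
  refine Submodule.eq_starProjection_of_mem_orthogonal (K := (U ⊓ V).toSubmodule)
    (v := (proj U * proj V) x) ⟨proj_apply_mem U _, ?_⟩ ?_
  · rw [h.eq]
    exact proj_apply_mem V _
  · refine (Submodule.mem_orthogonal _ _).2 fun y hy => ?_
    have hU : proj U y = y := proj_apply_eq_self_iff.2 hy.1
    have hV : proj V y = y := proj_apply_eq_self_iff.2 hy.2
    have e1 := (isSelfAdjoint_proj U).isSymmetric y (proj V x)
    have e2 := (isSelfAdjoint_proj V).isSymmetric y x
    simp only [ContinuousLinearMap.coe_coe, hU, hV] at e1 e2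
    rw [inner_sub_right, e2, e1, sub_eq_zero]
    rfl

theorem sup_eq_orthogonal (U V : ClosedSubmodule ℂ H) : U ⊔ V = (Uᗮ ⊓ Vᗮ)ᗮ := by
  rw [← ClosedSubmodule.sup_orthogonal]
  simp

theorem proj_sup (h : Commute (proj U) (proj V)) :
    proj (U ⊔ V) = proj U + proj V - proj U * proj V := by
  rw [sup_eq_orthogonal, proj_orthogonal, proj_inf, proj_orthogonal, proj_orthogonal]
  · noncomm_ring
  · rw [proj_orthogonal, proj_orthogonal]
    exact ((Commute.one_left _).sub_left ((Commute.one_right _).sub_right h))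

theorem sup_orthogonal_self (U : ClosedSubmodule ℂ H) : U ⊔ Uᗮ = ⊤ := by
  rw [sup_eq_orthogonal]
  simp [inf_comm, ClosedSubmodule.inf_orthogonal_eq_bot]

end Proj

/-! ### Spectral subspaces -/

/-- A self-adjoint `A` satisfies `A ≤ l` on `σ_A(l)` and `l ≤ A` on its orthocomplement:
`A - l` is the difference of its positive and negative parts, whose product vanishes. -/
theorem spectralFamily_bounds {A : H →L[ℂ] H} (hA : IsSelfAdjoint A) (l : ℝ) :
    (∀ x ∈ spectralFamily A l, (⟪x, A x⟫_ℂ).re ≤ l * ‖x‖ ^ 2) ∧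
      ∀ x ∈ (spectralFamily A l)ᗮ, l * ‖x‖ ^ 2 ≤ (⟪x, A x⟫_ℂ).re := by
  set p : H →L[ℂ] H := cfc (fun t : ℝ => max (t - l) 0) A with hp
  set n : H →L[ℂ] H := cfc (fun t : ℝ => max (l - t) 0) A with hn
  have hsub : A = (l : ℂ) • 1 + p - n := by
    have h1 : cfc (fun t : ℝ => l + max (t - l) 0 - max (l - t) 0) A = (l : ℂ) • 1 + p - n := by
      rw [cfc_sub (fun t : ℝ => l + max (t - l) 0) _ A, cfc_add A (fun _ : ℝ => l) _, cfc_const l A,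
        Algebra.algebraMap_eq_smul_one]
      rfl
    have h2 : (fun t : ℝ => l + max (t - l) 0 - max (l - t) 0) = id := by
      funext t
      rcases le_total t l with h | h
      · simp [max_eq_right (sub_nonpos.2 h), max_eq_left (sub_nonneg.2 h)]
      · simp [max_eq_left (sub_nonneg.2 h), max_eq_right (sub_nonpos.2 h)]
    rw [← h1, h2, cfc_id ℝ A]
  have hpn : p * n = 0 := by
    rw [hp, hn, ← cfc_mul (fun t : ℝ => max (t - l) 0) (fun t => max (l - t) 0) A]
    convert cfc_zero (R := ℝ) A using 2
    funext t
    rcases le_total t l with h | h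
    · simp [max_eq_right (sub_nonpos.2 h)]
    · simp [max_eq_right (sub_nonpos.2 h)]
  have hp0 : p.IsPositive := (ContinuousLinearMap.nonneg_iff_isPositive p).1
    (cfc_nonneg fun t _ => le_max_right _ _)
  have hn0 : n.IsPositive := (ContinuousLinearMap.nonneg_iff_isPositive n).1
    (cfc_nonneg fun t _ => le_max_right _ _)
  have key : ∀ x, (⟪x, A x⟫_ℂ).re = l * ‖x‖ ^ 2 + (⟪x, p x⟫_ℂ).re - (⟪x, n x⟫_ℂ).re := by
    intro x
    conv_lhs => rw [hsub]
    simp only [sub_apply, add_apply, smul_apply, one_apply_eq_self, inner_sub_right,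
      inner_add_right, inner_smul_right, inner_self_eq_norm_sq_to_K]
    rw [Complex.sub_re, Complex.add_re, Complex.re_ofReal_mul]
    norm_cast
  refine ⟨fun x hx => ?_, fun x hx => ?_⟩
  · have hx0 : p x = 0 := hx
    have := hn0.re_inner_nonneg_right x
    rw [key, hx0, inner_zero_right]
    simp only [RCLike.re_to_complex, Complex.zero_re] at this ⊢
    linarith
  · have hnx : n x ∈ spectralFamily A l := congrArg (fun T : H →L[ℂ] H => T x) hpn
    have h0 : ⟪x, n x⟫_ℂ = 0 := (ClosedSubmodule.mem_orthogonal' _ _).1 hx _ hnx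
    have := hp0.re_inner_nonneg_right x
    rw [key, h0]
    simp only [RCLike.re_to_complex, Complex.zero_re] at this ⊢
    linarith

/-! ### Boolean sectors -/

variable {B : Sublattice (ClosedSubmodule ℂ H)}

/-- The lattice of the projections in a commutative algebra of operators. -/
def projectionLattice (M : Subalgebra ℂ (H →L[ℂ] H)) (hM : ∀ S ∈ M, ∀ T ∈ M, Commute S T) :
    Sublattice (ClosedSubmodule ℂ H) where
  carrier := {U | proj U ∈ M}
  supClosed' U hU V hV := by
    change proj (U ⊔ V) ∈ M
    rw [proj_sup (hM _ hU _ hV)]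
    exact M.sub_mem (M.add_mem hU hV) (M.mul_mem hU hV)
  infClosed' U hU V hV := by
    change proj (U ⊓ V) ∈ M
    rw [proj_inf (hM _ hU _ hV)]
    exact M.mul_mem hU hV

theorem isDistributiveSublattice_projectionLattice (M : Subalgebra ℂ (H →L[ℂ] H))
    (hM : ∀ S ∈ M, ∀ T ∈ M, Commute S T) :
    IsDistributiveSublattice (projectionLattice M hM) where
  bot_mem := by
    change proj ⊥ ∈ M
    rw [proj_bot]
    exact M.zero_mem
  top_mem := by
    change proj ⊤ ∈ M
    rw [proj_top]
    exact M.one_mem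
  inf_sup U hU V hV W hW := by
    have hUV := hM _ hU _ hV
    have hUW := hM _ hU _ hW
    have hVW := hM _ hV _ hW
    have h1 := hM _ hU _ ((projectionLattice M hM).supClosed hV hW)
    have h2 := hM _ ((projectionLattice M hM).infClosed hU hV) _
      ((projectionLattice M hM).infClosed hU hW)
    apply proj_injective
    rw [proj_inf h1, proj_sup hVW, proj_sup h2, proj_inf hUV, proj_inf hUW]
    have e : proj U * proj V * (proj U * proj W) = proj U * (proj V * proj W) := by
      rw [mul_assoc, ← mul_assoc (proj V), ← hUV.eq, mul_assoc, ← mul_assoc (proj U),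
        proj_mul_self]
    rw [e]
    noncomm_ring
  sup_inf U hU V hV W hW := by
    have hUV := hM _ hU _ hV
    have hUW := hM _ hU _ hW
    have hVW := hM _ hV _ hW
    have h1 := hM _ hU _ ((projectionLattice M hM).infClosed hV hW)
    have h2 := hM _ ((projectionLattice M hM).supClosed hU hV) _
      ((projectionLattice M hM).supClosed hU hW)
    apply proj_injective
    rw [proj_sup h1, proj_inf hVW, proj_inf h2, proj_sup hUV, proj_sup hUW]
    have e0 := proj_mul_self U
    have e1 : proj U * (proj U * proj W) = proj U * proj W := by rw [← mul_assoc, e0]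
    have e2 : proj V * proj U = proj U * proj V := hUV.eq.symm
    have e3 : proj V * (proj U * proj W) = proj U * (proj V * proj W) := by
      rw [← mul_assoc, e2, mul_assoc]
    have e4 : proj U * (proj U * (proj V * proj W)) = proj U * (proj V * proj W) := by
      rw [← mul_assoc, e0]
    have e5 : proj U * (proj U * proj V) = proj U * proj V := by rw [← mul_assoc, e0]
    simp only [mul_add, add_mul, mul_sub, sub_mul, mul_assoc, e0, e1, e2, e3, e4, e5]
    abel

namespace IsBooleanSector

variable (hB : IsBooleanSector B)
include hB

theorem commute_proj {U V : ClosedSubmodule ℂ H} (hU : U ∈ B) (hV : V ∈ B) :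
    Commute (proj U) (proj V) := by
  refine commute_proj_of_forall_mem (isSelfAdjoint_proj U) fun x hx => ?_
  -- By distributivity `V` is the join of `V ⊓ U` and `V ⊓ Uᗮ`, which are both invariant.
  have h := hB.maximal.prop.inf_sup V hV U hU Uᗮ (hB.orthogonal_mem U hU)
  rw [sup_orthogonal_self, inf_top_eq] at h
  have hle : V ≤ V.comap (proj U) := by
    conv_lhs => rw [h]
    refine sup_le (fun y hy => ?_) fun y hy => ?_
    · change proj U y ∈ V
      rw [proj_apply_eq_self_iff.2 hy.2]
      exact hy.1
    · change proj U y ∈ V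
      rw [proj_apply_eq_zero_iff.2 hy.2]
      exact zero_mem V
  exact hle hx

/-- A Boolean sector contains every closed subspace whose projection commutes with those of the
sector: together they generate a commutative algebra, and the projections of that algebra form a
distributive sublattice containing the sector. -/
theorem mem_of_commute {W : ClosedSubmodule ℂ H} (hW : ∀ V ∈ B, Commute (proj W) (proj V)) :
    W ∈ B := by
  let S : Set (H →L[ℂ] H) := proj '' {U | U ∈ B ∨ U = W}
  have hS : S ⊆ S.centralizer := by
    rintro _ ⟨U, hU, rfl⟩ _ ⟨V, hV, rfl⟩
    rcases hU with hU | rfl <;> rcases hV with hV | rfl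
    · exact hB.commute_proj hV hU
    · exact hW U hU
    · exact (hW V hV).symm
    · rfl
  let M : Subalgebra ℂ (H →L[ℂ] H) := Subalgebra.centralizer ℂ S.centralizer
  have hSM : S ⊆ M := Set.subset_centralizer_centralizer
  have hM : ∀ P ∈ M, ∀ Q ∈ M, Commute P Q := fun P hP Q hQ =>
    hQ P (Set.centralizer_subset hS hP)
  have hle : B ≤ projectionLattice M hM := fun U hU => hSM ⟨U, Or.inl hU, rfl⟩
  exact hB.maximal.le_of_ge (isDistributiveSublattice_projectionLattice M hM) hle
    (hSM ⟨W, Or.inr rfl, rfl⟩)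

theorem mem_of_forall_invariant {W : ClosedSubmodule ℂ H}
    (hW : ∀ V ∈ B, ∀ x ∈ W, proj V x ∈ W) : W ∈ B :=
  hB.mem_of_commute fun V hV =>
    (commute_proj_of_forall_mem (isSelfAdjoint_proj V) (hW V hV)).symm

/-- The orthocomplement, as an operation on a Boolean sector. -/
noncomputable def compl (U : B) : B := ⟨(U : ClosedSubmodule ℂ H)ᗮ, hB.orthogonal_mem U U.2⟩

omit [CompleteSpace H] in
theorem isBot_iff {U : B} : IsBot U ↔ (U : ClosedSubmodule ℂ H) = ⊥ :=
  ⟨fun h => le_bot_iff.1 (h ⟨⊥, hB.maximal.prop.bot_mem⟩), fun h V => by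
    change (U : ClosedSubmodule ℂ H) ≤ V
    rw [h]
    exact bot_le⟩

theorem isBot_inf_iff_le_compl (U V : B) : IsBot (V ⊓ U) ↔ V ≤ hB.compl U := by
  rw [hB.isBot_iff]
  constructor
  · intro h
    have hd := hB.maximal.prop.inf_sup V V.2 U U.2 _ (hB.orthogonal_mem U U.2)
    have h' : (V : ClosedSubmodule ℂ H) ⊓ U = ⊥ := h
    rw [sup_orthogonal_self, inf_top_eq, h', bot_sup_eq] at hd
    change (V : ClosedSubmodule ℂ H) ≤ (U : ClosedSubmodule ℂ H)ᗮ
    rw [hd]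
    exact inf_le_right
  · intro h
    have h' : (V : ClosedSubmodule ℂ H) ≤ (U : ClosedSubmodule ℂ H)ᗮ := h
    refine le_bot_iff.1 ((inf_le_inf_right _ h').trans ?_)
    rw [inf_comm, ClosedSubmodule.inf_orthogonal_eq_bot]

theorem compl_mem_iff {β : Quasipoint B} {U : B} : hB.compl U ∈ β.1 ↔ U ∉ β.1 :=
  Quasipoint.compl_mem_iff hB.isBot_inf_iff_le_compl

theorem compactSpace_quasipoint : CompactSpace (Quasipoint B) :=
  Quasipoint.compactSpace hB.isBot_inf_iff_le_compl

omit [CompleteSpace H] in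
theorem exists_ne_zero {β : Quasipoint B} {U : B} (hU : U ∈ β.1) :
    ∃ x ∈ (U : ClosedSubmodule ℂ H), x ≠ 0 := by
  by_contra! h
  exact β.2.prop.not_isBot U hU (hB.isBot_iff.2 (le_bot_iff.1 fun x hx => h x hx))

/-- Only the whole space belongs to all quasipoints. -/
theorem eq_top_of_forall_mem {U : B} (h : ∀ β : Quasipoint B, U ∈ β.1) :
    (U : ClosedSubmodule ℂ H) = ⊤ := by
  by_contra hU
  obtain ⟨β, hβ⟩ := exists_quasipoint_mem (a := hB.compl U) fun hbot => hU (by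
    have h' : (U : ClosedSubmodule ℂ H)ᗮ = ⊥ := hB.isBot_iff.1 hbot
    rw [← ClosedSubmodule.orthogonal_orthogonal_eq (U : ClosedSubmodule ℂ H), h',
      ClosedSubmodule.bot_orthogonal_eq_top])
  exact hB.compl_mem_iff.1 hβ (h β)

/-- The operators in `C*(B)` commute with the projections of the sector. -/
theorem commute_of_mem_cstar {A : H →L[ℂ] H} (hA : A ∈ cstar B) {U : ClosedSubmodule ℂ H}
    (hU : U ∈ B) : Commute A (proj U) := by
  have hle : cstar B ≤ (Subalgebra.centralizer ℂ {proj U}).toSubmodule := by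
    refine Submodule.topologicalClosure_minimal _ (Submodule.span_le.2 ?_) ?_
    · rintro _ ⟨V, hV, rfl⟩ _ rfl
      exact hB.commute_proj hU hV
    · exact Set.isClosed_centralizer _
  exact (hle hA _ rfl).symm

/-- The spectral subspaces of the operators in `C*(B)` belong to the sector. -/
theorem spectralFamily_mem {A : H →L[ℂ] H} (hA : A ∈ cstar B) (l : ℝ) :
    spectralFamily A l ∈ B := by
  refine hB.mem_of_forall_invariant fun V hV x hx => ?_
  have hc := (hB.commute_of_mem_cstar hA hV).cfc_real (fun t : ℝ => max (t - l) 0)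
  have hx' : cfc (fun t : ℝ => max (t - l) 0) A x = 0 := hx
  change cfc (fun t : ℝ => max (t - l) 0) A (proj V x) = 0
  have := congrArg (fun T : H →L[ℂ] H => T x) hc.eq
  simpa [hx'] using this

end IsBooleanSector

end ClosedSubspaces

section Values

variable {H : Type u} [NormedAddCommGroup H] [InnerProductSpace ℂ H]

/-! ### Values of operators at quasipoints -/

/-- `A` acts approximately as the scalar `c` on small elements of the quasipoint `β`. For operators
in `C*(B)` this says that the character of `C*(B)` given by `β` maps `A` to `c`. -/
def HasValueAt {B : Sublattice (ClosedSubmodule ℂ H)} (β : Quasipoint B) (A : H →L[ℂ] H)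
    (c : ℂ) : Prop :=
  ∀ ε > 0, ∃ U ∈ β.1, ∀ x ∈ (U : ClosedSubmodule ℂ H), ‖A x - c • x‖ ≤ ε * ‖x‖

variable {B : Sublattice (ClosedSubmodule ℂ H)} {β : Quasipoint B} {A A' : H →L[ℂ] H} {c c' : ℂ}

theorem HasValueAt.add (h : HasValueAt β A c) (h' : HasValueAt β A' c') :
    HasValueAt β (A + A') (c + c') := fun ε hε => by
  obtain ⟨U, hU, hle⟩ := h (ε / 2) (half_pos hε)
  obtain ⟨V, hV, hle'⟩ := h' (ε / 2) (half_pos hε)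
  refine ⟨U ⊓ V, Quasipoint.inf_mem hU hV, fun x hx => ?_⟩
  calc ‖(A + A') x - (c + c') • x‖ = ‖(A x - c • x) + (A' x - c' • x)‖ := by
        rw [add_smul, add_apply, add_sub_add_comm]
    _ ≤ ε / 2 * ‖x‖ + ε / 2 * ‖x‖ := norm_add_le_of_le (hle x hx.1) (hle' x hx.2)
    _ = ε * ‖x‖ := by ring

theorem HasValueAt.smul (h : HasValueAt β A c) (a : ℂ) : HasValueAt β (a • A) (a * c) :=
  fun ε hε => by
  obtain ⟨U, hU, hle⟩ := h (ε / (‖a‖ + 1)) (by positivity)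
  refine ⟨U, hU, fun x hx => ?_⟩
  calc ‖(a • A) x - (a * c) • x‖ = ‖a‖ * ‖A x - c • x‖ := by
        rw [mul_smul, smul_apply, ← smul_sub, norm_smul]
    _ ≤ (‖a‖ + 1) * (ε / (‖a‖ + 1) * ‖x‖) := by
        gcongr
        · linarith
        · exact hle x hx
    _ = ε * ‖x‖ := by field_simp

theorem HasValueAt.sub (h : HasValueAt β A c) (h' : HasValueAt β A' c') :
    HasValueAt β (A - A') (c - c') := by
  have := h.add (h'.smul (-1))
  rwa [neg_one_smul, neg_one_mul, ← sub_eq_add_neg, ← sub_eq_add_neg] at this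

/-- An operator has at most one value at a quasipoint, since a quasipoint contains neither zero
nor two disjoint elements. -/
theorem HasValueAt.unique (hB : IsBooleanSector B) (h : HasValueAt β A c)
    (h' : HasValueAt β A c') : c = c' := by
  refine sub_eq_zero.1 (norm_le_zero_iff.1 (le_of_forall_pos_le_add fun ε hε => ?_))
  obtain ⟨U, hU, hle⟩ := h.sub h' ε hε
  obtain ⟨x, hx, hx0⟩ := hB.exists_ne_zero hU
  have := hle x hx
  rw [sub_self, zero_apply, zero_sub, norm_neg, norm_smul] at this
  rw [zero_add]
  exact le_of_mul_le_mul_right this (norm_pos_iff.2 hx0)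

/-- The value at an atomic quasipoint is an eigenvalue. -/
theorem HasValueAt.apply_eq (h : HasValueAt β A c) {x : H}
    (hx : ∀ U ∈ β.1, x ∈ (U : ClosedSubmodule ℂ H)) : A x = c • x := by
  refine sub_eq_zero.1 (norm_le_zero_iff.1 (le_of_forall_pos_le_add fun ε hε => ?_))
  obtain ⟨U, hU, hle⟩ := h (ε / (‖x‖ + 1)) (by positivity)
  refine (hle x (hx U hU)).trans ?_
  rw [zero_add, div_mul_eq_mul_div, div_le_iff₀ (by positivity)]
  nlinarith [norm_nonneg x]

theorem hasValueAt_of_tendsto {A : ℕ → H →L[ℂ] H} {c : ℕ → ℂ} {A' : H →L[ℂ] H} {c' : ℂ}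
    (h : ∀ n, HasValueAt β (A n) (c n)) (hA : Filter.Tendsto A Filter.atTop (nhds A'))
    (hc : Filter.Tendsto c Filter.atTop (nhds c')) : HasValueAt β A' c' := fun ε hε => by
  have h3 : 0 < ε / 3 := by positivity
  obtain ⟨n, hAn, hcn⟩ := ((Metric.tendsto_nhds.1 hA _ h3).and
    (Metric.tendsto_nhds.1 hc _ h3)).exists
  obtain ⟨U, hU, hle⟩ := h n _ h3
  refine ⟨U, hU, fun x hx => ?_⟩
  rw [dist_comm, dist_eq_norm] at hAn
  rw [dist_eq_norm] at hcn
  calc ‖A' x - c' • x‖ = ‖(A' - A n) x + (A n x - c n • x) + (c n - c') • x‖ := by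
        congr 1
        rw [sub_apply, sub_smul]
        abel
    _ ≤ ε / 3 * ‖x‖ + ε / 3 * ‖x‖ + ε / 3 * ‖x‖ := by
        refine norm_add_le_of_le (norm_add_le_of_le ?_ (hle x hx)) ?_
        · exact (A' - A n).le_of_opNorm_le hAn.le x
        · rw [norm_smul]
          gcongr
    _ = ε * ‖x‖ := by ring

theorem hasValueAt_zero (β : Quasipoint B) : HasValueAt β 0 0 := fun ε hε => by
  obtain ⟨U, hU⟩ := β.2.prop.nonempty
  refine ⟨U, hU, fun x _ => ?_⟩
  rw [zero_apply, zero_smul, sub_zero, norm_zero]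
  positivity

variable [CompleteSpace H]

theorem hasValueAt_proj_of_mem {U : B} (hU : U ∈ β.1) : HasValueAt β (proj U.1) 1 :=
  fun ε hε => ⟨U, hU, fun x hx => by
    rw [proj_apply_eq_self_iff.2 hx, one_smul, sub_self, norm_zero]
    positivity⟩

theorem hasValueAt_proj_of_notMem (hB : IsBooleanSector B) {U : B} (hU : U ∉ β.1) :
    HasValueAt β (proj U.1) 0 :=
  fun ε hε => ⟨hB.compl U, hB.compl_mem_iff.2 hU, fun x hx => by
    rw [proj_apply_eq_zero_iff.2 hx, zero_smul, sub_self, norm_zero]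
    positivity⟩

theorem exists_hasValueAt_of_mem_span (hB : IsBooleanSector B) (β : Quasipoint B)
    (hA : A ∈ Submodule.span ℂ (proj '' (B : Set (ClosedSubmodule ℂ H)))) :
    ∃ c, HasValueAt β A c := by
  refine Submodule.span_induction (p := fun S _ => ∃ c, HasValueAt β S c) ?_ ?_ ?_ ?_ hA
  · rintro _ ⟨U, hU, rfl⟩
    lift U to B using hU
    by_cases h : U ∈ β.1
    · exact ⟨1, hasValueAt_proj_of_mem h⟩
    · exact ⟨0, hasValueAt_proj_of_notMem hB h⟩
  · exact ⟨0, hasValueAt_zero β⟩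
  · rintro S T _ _ ⟨c, hc⟩ ⟨d, hd⟩
    exact ⟨c + d, hc.add hd⟩
  · rintro a S _ ⟨c, hc⟩
    exact ⟨a * c, hc.smul a⟩

/-- Every operator in `C*(B)` is approximately scalar on small elements of a quasipoint. -/
theorem exists_approx_of_mem_cstar (hB : IsBooleanSector B) (hA : A ∈ cstar B)
    (β : Quasipoint B) {ε : ℝ} (hε : 0 < ε) :
    ∃ U ∈ β.1, ∃ c : ℂ, ∀ x ∈ (U : ClosedSubmodule ℂ H), ‖A x - c • x‖ ≤ ε * ‖x‖ := by
  obtain ⟨S, hS, hAS⟩ := Metric.mem_closure_iff.1 (SetLike.mem_coe.2 hA) (ε / 2) (half_pos hε)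
  obtain ⟨c, hc⟩ := exists_hasValueAt_of_mem_span hB β hS
  obtain ⟨U, hU, hle⟩ := hc (ε / 2) (half_pos hε)
  refine ⟨U, hU, c, fun x hx => ?_⟩
  rw [dist_eq_norm] at hAS
  calc ‖A x - c • x‖ = ‖(A - S) x + (S x - c • x)‖ := by rw [sub_apply, sub_add_sub_cancel]
    _ ≤ ε / 2 * ‖x‖ + ε / 2 * ‖x‖ :=
        norm_add_le_of_le ((A - S).le_of_opNorm_le hAS.le x) (hle x hx)
    _ = ε * ‖x‖ := by ring

omit [CompleteSpace H] in
theorem re_inner_bounds {c : ℂ} {ε : ℝ} {x : H} (h : ‖A x - c • x‖ ≤ ε * ‖x‖) :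
    |(⟪x, A x⟫_ℂ).re - c.re * ‖x‖ ^ 2| ≤ ε * ‖x‖ ^ 2 ∧
      |(⟪x, A x⟫_ℂ).im - c.im * ‖x‖ ^ 2| ≤ ε * ‖x‖ ^ 2 := by
  have h1 : ⟪x, A x - c • x⟫_ℂ = ⟪x, A x⟫_ℂ - c * ((‖x‖ ^ 2 : ℝ) : ℂ) := by
    rw [inner_sub_right, inner_smul_right, inner_self_eq_norm_sq_to_K]
    norm_cast
  have h2 : ‖⟪x, A x - c • x⟫_ℂ‖ ≤ ε * ‖x‖ ^ 2 := by
    refine (norm_inner_le_norm _ _).trans ?_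
    calc ‖x‖ * ‖A x - c • x‖ ≤ ‖x‖ * (ε * ‖x‖) := by gcongr
      _ = ε * ‖x‖ ^ 2 := by ring
  have hre := (Complex.abs_re_le_norm _).trans h2
  have him := (Complex.abs_im_le_norm _).trans h2
  rw [h1, Complex.sub_re, Complex.re_mul_ofReal] at hre
  rw [h1, Complex.sub_im, Complex.im_mul_ofReal] at him
  exact ⟨hre, him⟩

/-- The spectral family of `A` belongs to `β` above the value of `A` at `β` and does not below it. -/
theorem spectralFamily_mem_quasipoint (hB : IsBooleanSector B) (hA : A ∈ cstar B)
    (hsa : IsSelfAdjoint A) {U : B} (hU : U ∈ β.1) {c : ℂ} {ε : ℝ}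
    (hle : ∀ x ∈ (U : ClosedSubmodule ℂ H), ‖A x - c • x‖ ≤ ε * ‖x‖) (l : ℝ) :
    (c.re + ε < l → (⟨spectralFamily A l, hB.spectralFamily_mem hA l⟩ : B) ∈ β.1) ∧
      ((⟨spectralFamily A l, hB.spectralFamily_mem hA l⟩ : B) ∈ β.1 → c.re - ε ≤ l) := by
  set E : B := ⟨spectralFamily A l, hB.spectralFamily_mem hA l⟩
  obtain ⟨hb1, hb2⟩ := spectralFamily_bounds hsa l
  constructor
  · intro hl
    by_contra hE
    obtain ⟨x, hx, hx0⟩ := hB.exists_ne_zero (Quasipoint.inf_mem hU (hB.compl_mem_iff.2 hE))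
    have hpos : 0 < ‖x‖ ^ 2 := by positivity
    have h1 := (abs_le.1 (re_inner_bounds (hle x hx.1)).1).2
    have h2 := hb2 x hx.2
    nlinarith
  · intro hE
    obtain ⟨x, hx, hx0⟩ := hB.exists_ne_zero (Quasipoint.inf_mem hU hE)
    have hpos : 0 < ‖x‖ ^ 2 := by positivity
    have h1 := (abs_le.1 (re_inner_bounds (hle x hx.1)).1).1
    have h2 := hb1 x hx.2
    by_contra! hl
    nlinarith

theorem abs_observableFunction_sub_le (hB : IsBooleanSector B) (hA : A ∈ cstar B)
    (hsa : IsSelfAdjoint A) {U : B} (hU : U ∈ β.1) {c : ℂ} {ε : ℝ}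
    (hle : ∀ x ∈ (U : ClosedSubmodule ℂ H), ‖A x - c • x‖ ≤ ε * ‖x‖) :
    |observableFunction B A β - c.re| ≤ ε := by
  have key := spectralFamily_mem_quasipoint hB hA hsa hU hle
  have hlow : c.re - ε ∈ lowerBounds
      {l : ℝ | ∃ U ∈ β.1, (U : ClosedSubmodule ℂ H) = spectralFamily A l} := by
    rintro l ⟨V, hV, hVl⟩
    refine (key l).2 ?_
    convert hV
    exact hVl.symm
  have hmem : ∀ l, c.re + ε < l →
      l ∈ {l : ℝ | ∃ U ∈ β.1, (U : ClosedSubmodule ℂ H) = spectralFamily A l} :=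
    fun l hl => ⟨_, (key l).1 hl, rfl⟩
  have h1 : c.re - ε ≤ observableFunction B A β :=
    le_csInf ⟨_, hmem (c.re + ε + 1) (by linarith)⟩ hlow
  have h2 : observableFunction B A β ≤ c.re + ε :=
    le_of_forall_gt_imp_ge_of_dense fun l hl => csInf_le ⟨_, hlow⟩ (hmem l hl)
  rw [abs_le]
  constructor <;> linarith

/-- The observable function of a self-adjoint operator in `C*(B)` gives its value at each
quasipoint. -/
theorem hasValueAt_observableFunction (hB : IsBooleanSector B) (hA : A ∈ cstar B)
    (hsa : IsSelfAdjoint A) (β : Quasipoint B) :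
    HasValueAt β A (observableFunction B A β) := fun ε hε => by
  have h3 : 0 < ε / 3 := by positivity
  obtain ⟨U, hU, c, hle⟩ := exists_approx_of_mem_cstar hB hA β h3
  refine ⟨U, hU, fun x hx => ?_⟩
  have hre := abs_observableFunction_sub_le hB hA hsa hU hle
  -- The scalar `c` is almost real, because the quadratic form of `A` is real.
  have him : |c.im| ≤ ε / 3 := by
    obtain ⟨y, hy, hy0⟩ := hB.exists_ne_zero hU
    have hpos : 0 < ‖y‖ ^ 2 := by positivity
    have h1 := (re_inner_bounds (hle y hy)).2
    have h2 : (⟪y, A y⟫_ℂ).im = 0 := by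
      have := hsa.isSymmetric.im_inner_self_apply y
      simpa using this
    rw [h2, zero_sub, abs_neg, abs_mul, abs_of_pos hpos] at h1
    exact le_of_mul_le_mul_right h1 hpos
  have hc : ‖c - (observableFunction B A β : ℂ)‖ ≤ ε / 3 + ε / 3 := by
    refine (Complex.norm_le_abs_re_add_abs_im _).trans (add_le_add ?_ ?_)
    · rw [Complex.sub_re, Complex.ofReal_re, abs_sub_comm]
      exact hre
    · rwa [Complex.sub_im, Complex.ofReal_im, sub_zero]
  calc ‖A x - (observableFunction B A β : ℂ) • x‖
      = ‖(A x - c • x) + (c - (observableFunction B A β : ℂ)) • x‖ := by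
        rw [sub_smul, sub_add_sub_cancel]
    _ ≤ ε / 3 * ‖x‖ + (ε / 3 + ε / 3) * ‖x‖ := by
        refine norm_add_le_of_le (hle x hx) ?_
        rw [norm_smul]
        gcongr
    _ = ε * ‖x‖ := by ring

theorem observableFunction_eq (hB : IsBooleanSector B) (hA : A ∈ cstar B)
    (hsa : IsSelfAdjoint A) {c : ℝ} (h : HasValueAt β A c) : observableFunction B A β = c :=
  Complex.ofReal_injective ((hasValueAt_observableFunction hB hA hsa β).unique hB h)

/-! ### The observable function determines the norm -/

theorem re_inner_le_of_value_le (hB : IsBooleanSector B) (hA : A ∈ cstar B)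
    (hsa : IsSelfAdjoint A) {r : ℝ} {f : Quasipoint B → ℝ}
    (hf : ∀ β, HasValueAt β A (f β)) (hr : ∀ β, f β ≤ r) (x : H) :
    (⟪x, A x⟫_ℂ).re ≤ r * ‖x‖ ^ 2 := by
  -- For `l > r` the spectral subspace belongs to every quasipoint, so that it is everything.
  have h : ∀ l, r < l → (⟪x, A x⟫_ℂ).re ≤ l * ‖x‖ ^ 2 := fun l hl => by
    have htop : spectralFamily A l = ⊤ :=
      hB.eq_top_of_forall_mem (U := ⟨_, hB.spectralFamily_mem hA l⟩) fun β => by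
        obtain ⟨U, hU, hle⟩ := hf β ((l - r) / 2) (by linarith)
        refine (spectralFamily_mem_quasipoint hB hA hsa hU hle l).1 ?_
        have := hr β
        rw [Complex.ofReal_re]
        linarith
    exact (spectralFamily_bounds hsa l).1 x (htop ▸ ClosedSubmodule.mem_top)
  refine le_of_forall_pos_le_add fun ε hε => (h (r + ε / (‖x‖ ^ 2 + 1)) ?_).trans ?_
  · have : 0 < ε / (‖x‖ ^ 2 + 1) := by positivity
    linarith
  · have : ε / (‖x‖ ^ 2 + 1) * ‖x‖ ^ 2 ≤ ε := by
      rw [div_mul_eq_mul_div, div_le_iff₀ (by positivity)]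
      nlinarith [sq_nonneg ‖x‖]
    linarith

theorem norm_le_of_abs_value_le (hB : IsBooleanSector B) (hA : A ∈ cstar B)
    (hsa : IsSelfAdjoint A) {r : ℝ} (hr0 : 0 ≤ r) {f : Quasipoint B → ℝ}
    (hf : ∀ β, HasValueAt β A (f β)) (hr : ∀ β, |f β| ≤ r) : ‖A‖ ≤ r := by
  have h1 := re_inner_le_of_value_le hB hA hsa hf fun β => (abs_le.1 (hr β)).2
  have h2 := re_inner_le_of_value_le hB ((cstar B).neg_mem hA) hsa.neg (f := fun β => -f β)
    (fun β => by simpa using (hf β).smul (-1)) fun β => by linarith [(abs_le.1 (hr β)).1]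
  rw [A.norm_eq_iSup_rayleighQuotient hsa.isSymmetric]
  refine ciSup_le fun x => ?_
  rw [ContinuousLinearMap.rayleighQuotient, ContinuousLinearMap.reApplyInnerSelf_apply,
    inner_re_symm, abs_div, abs_of_nonneg (sq_nonneg ‖x‖)]
  refine div_le_of_le_mul₀ (sq_nonneg _) hr0 (abs_le.2 ⟨?_, h1 x⟩)
  have := h2 x
  rw [neg_apply, inner_neg_right, Complex.neg_re] at this
  exact neg_le.1 this

end Values
section Realisation

variable {H : Type u} [NormedAddCommGroup H] [InnerProductSpace ℂ H] [CompleteSpace H]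
  {B : Sublattice (ClosedSubmodule ℂ H)}

/-! ### Continuous functions on the Stonean space as observable functions -/

open Classical in
/-- The indicator function of the clopen set of quasipoints containing `U`. -/
noncomputable def indicatorMap (hB : IsBooleanSector B) (U : B) : C(Quasipoint B, ℝ) :=
  (LocallyConstant.charFn ℝ
    (Quasipoint.isClopen_basicOpen hB.isBot_inf_iff_le_compl U)).toContinuousMap

theorem indicatorMap_of_mem (hB : IsBooleanSector B) {U : B} {β : Quasipoint B} (h : U ∈ β.1) :
    indicatorMap hB U β = 1 :=
  Set.indicator_of_mem (s := Quasipoint.basicOpen U) h _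

theorem indicatorMap_of_notMem (hB : IsBooleanSector B) {U : B} {β : Quasipoint B}
    (h : U ∉ β.1) : indicatorMap hB U β = 0 :=
  Set.indicator_of_notMem (s := Quasipoint.basicOpen U) h _

theorem proj_mem_cstar (U : B) : proj U.1 ∈ cstar B :=
  Submodule.le_topologicalClosure _ (Submodule.subset_span ⟨U.1, U.2, rfl⟩)

theorem hasValueAt_proj (hB : IsBooleanSector B) (U : B) (β : Quasipoint B) :
    HasValueAt β (proj U.1) (indicatorMap hB U β : ℝ) := by
  by_cases h : U ∈ β.1
  · rw [indicatorMap_of_mem hB h, Complex.ofReal_one]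
    exact hasValueAt_proj_of_mem h
  · rw [indicatorMap_of_notMem hB h, Complex.ofReal_zero]
    exact hasValueAt_proj_of_notMem hB h

/-- The real functions on `Q(B)` that arise as values of self-adjoint operators in `C*(B)`. -/
def valueFunctions (B : Sublattice (ClosedSubmodule ℂ H)) : Submodule ℝ C(Quasipoint B, ℝ) where
  carrier := {φ | ∃ A ∈ cstar B, IsSelfAdjoint A ∧ ∀ β, HasValueAt β A (φ β)}
  add_mem' := by
    rintro φ ψ ⟨A, hA, hsa, hv⟩ ⟨A', hA', hsa', hv'⟩
    refine ⟨A + A', (cstar B).add_mem hA hA', hsa.add hsa', fun β => ?_⟩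
    rw [ContinuousMap.add_apply, Complex.ofReal_add]
    exact (hv β).add (hv' β)
  zero_mem' := ⟨0, (cstar B).zero_mem, .zero _, fun β => hasValueAt_zero β⟩
  smul_mem' := by
    rintro r φ ⟨A, hA, hsa, hv⟩
    refine ⟨(r : ℂ) • A, (cstar B).smul_mem _ hA, IsSelfAdjoint.smul (Complex.conj_ofReal r) hsa,
      fun β => ?_⟩
    rw [ContinuousMap.smul_apply, smul_eq_mul, Complex.ofReal_mul]
    exact (hv β).smul r

theorem adjoin_indicatorMap_le (hB : IsBooleanSector B) :
    (Algebra.adjoin ℝ (Set.range (indicatorMap hB))).toSubmodule ≤ valueFunctions B := by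
  rw [Algebra.adjoin_eq_span]
  refine Submodule.span_le.2 fun φ hφ => ?_
  -- The indicator functions are closed under multiplication.
  obtain ⟨U, rfl⟩ : φ ∈ Set.range (indicatorMap hB) := by
    induction hφ using Submonoid.closure_induction with
    | mem φ hφ => exact hφ
    | one =>
      refine ⟨⟨⊤, hB.maximal.prop.top_mem⟩, ContinuousMap.ext fun β => ?_⟩
      obtain ⟨U, hU⟩ := β.2.prop.nonempty
      exact indicatorMap_of_mem hB (Quasipoint.mem_of_le hU (le_top (a := U.1)))
    | mul φ ψ _ _ hφ hψ =>
      obtain ⟨U, rfl⟩ := hφ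
      obtain ⟨V, rfl⟩ := hψ
      refine ⟨U ⊓ V, ContinuousMap.ext fun β => ?_⟩
      rw [ContinuousMap.mul_apply]
      by_cases hU : U ∈ β.1 <;> by_cases hV : V ∈ β.1
      · rw [indicatorMap_of_mem hB (Quasipoint.inf_mem hU hV), indicatorMap_of_mem hB hU,
          indicatorMap_of_mem hB hV, one_mul]
      · rw [indicatorMap_of_notMem hB hV, mul_zero,
          indicatorMap_of_notMem hB fun h => hV (Quasipoint.inf_mem_iff.1 h).2]
      all_goals
        rw [indicatorMap_of_notMem hB hU, zero_mul,
          indicatorMap_of_notMem hB fun h => hU (Quasipoint.inf_mem_iff.1 h).1]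
  exact ⟨proj U.1, proj_mem_cstar U, isSelfAdjoint_proj U.1, hasValueAt_proj hB U⟩

theorem isClosed_valueFunctions (hB : IsBooleanSector B) :
    IsClosed (valueFunctions B : Set C(Quasipoint B, ℝ)) := by
  have := hB.compactSpace_quasipoint
  refine isClosed_of_closure_subset fun φ hφ => ?_
  obtain ⟨ψ, hψ, hlim⟩ := mem_closure_iff_seq_limit.1 hφ
  choose A hA hsa hv using hψ
  have hCauchy : CauchySeq A := by
    refine Metric.cauchySeq_iff'.2 fun ε hε => ?_
    obtain ⟨N, hN⟩ := Metric.cauchySeq_iff'.1 hlim.cauchySeq (ε / 2) (half_pos hε)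
    refine ⟨N, fun n hn => ?_⟩
    rw [dist_eq_norm]
    refine (norm_le_of_abs_value_le hB ((cstar B).sub_mem (hA n) (hA N)) ((hsa n).sub (hsa N))
      (half_pos hε).le (f := fun β => (ψ n - ψ N) β) (fun β => ?_) fun β => ?_).trans_lt
      (half_lt_self hε)
    · rw [ContinuousMap.sub_apply, Complex.ofReal_sub]
      exact (hv n β).sub (hv N β)
    · exact ((ψ n - ψ N).norm_coe_le_norm β).trans ((dist_eq_norm _ _).symm.trans_le (hN n hn).le)
  obtain ⟨A', hA'⟩ := cauchySeq_tendsto_of_complete hCauchy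
  refine ⟨A', (Submodule.isClosed_topologicalClosure _).mem_of_tendsto hA' (.of_forall hA),
    (isClosed_eq continuous_star continuous_id).mem_of_tendsto hA' (.of_forall hsa), fun β => ?_⟩
  exact hasValueAt_of_tendsto (fun n => hv n β) hA'
    ((Complex.continuous_ofReal.tendsto _).comp
      (((continuous_eval_const β).tendsto φ).comp hlim))

/-- By the Stone–Weierstrass theorem every continuous real function on `Q(B)` is the observable
function of a self-adjoint operator in `C*(B)`. -/
theorem exists_isSelfAdjoint_hasValueAt (hB : IsBooleanSector B) (φ : C(Quasipoint B, ℝ)) :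
    ∃ A ∈ cstar B, IsSelfAdjoint A ∧ ∀ β, HasValueAt β A (φ β) := by
  have := hB.compactSpace_quasipoint
  have hdense := ContinuousMap.subalgebra_topologicalClosure_eq_top_of_separatesPoints
    (Algebra.adjoin ℝ (Set.range (indicatorMap hB))) fun β γ hne => by
      obtain ⟨U, hU, hU'⟩ := Quasipoint.exists_mem_notMem hne
      refine ⟨_, ⟨indicatorMap hB U, Algebra.subset_adjoin ⟨U, rfl⟩, rfl⟩, ?_⟩
      change indicatorMap hB U β ≠ indicatorMap hB U γ
      rw [indicatorMap_of_mem hB hU, indicatorMap_of_notMem hB hU']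
      exact one_ne_zero
  have hφ : φ ∈ (Algebra.adjoin ℝ (Set.range (indicatorMap hB))).topologicalClosure :=
    hdense ▸ Algebra.mem_top
  exact closure_minimal (adjoin_indicatorMap_le hB) (isClosed_valueFunctions hB) hφ

theorem eq_of_observableFunction_eq (hB : IsBooleanSector B) {A A' : H →L[ℂ] H}
    (hA : A ∈ cstar B) (hA' : A' ∈ cstar B) (hsa : IsSelfAdjoint A) (hsa' : IsSelfAdjoint A')
    (h : ∀ β : Quasipoint B, observableFunction B A β = observableFunction B A' β) : A = A' := by
  refine sub_eq_zero.1 (norm_le_zero_iff.1 (norm_le_of_abs_value_le hB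
    ((cstar B).sub_mem hA hA') (hsa.sub hsa') le_rfl (f := fun _ => 0) (fun β => ?_) (by simp)))
  have := (hasValueAt_observableFunction hB hA hsa β).sub
    (hasValueAt_observableFunction hB hA' hsa' β)
  rwa [h β, sub_self] at this

/-- Values are complex linear in the operator, so `A_φ` has the values of `φ` although its
definition refers to real and imaginary parts only. -/
theorem IsOperatorOf.hasValueAt (hB : IsBooleanSector B) {φ : C(Quasipoint B, ℂ)}
    {A : H →L[ℂ] H} (h : IsOperatorOf B φ A) (β : Quasipoint B) : HasValueAt β A (φ β) := by
  obtain ⟨A₁, A₂, h₁, h₂, hs₁, hs₂, rfl, hf₁, hf₂⟩ := h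
  have := (hasValueAt_observableFunction hB h₁ hs₁ β).add
    ((hasValueAt_observableFunction hB h₂ hs₂ β).smul Complex.I)
  rwa [hf₁, hf₂, mul_comm, Complex.re_add_im] at this

theorem existsUnique_isOperatorOf (hB : IsBooleanSector B) (φ : C(Quasipoint B, ℂ)) :
    ∃! A : H →L[ℂ] H, IsOperatorOf B φ A := by
  obtain ⟨A₁, h₁, hs₁, hv₁⟩ := exists_isSelfAdjoint_hasValueAt hB
    ⟨fun β => (φ β).re, Complex.continuous_re.comp φ.continuous⟩
  obtain ⟨A₂, h₂, hs₂, hv₂⟩ := exists_isSelfAdjoint_hasValueAt hB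
    ⟨fun β => (φ β).im, Complex.continuous_im.comp φ.continuous⟩
  have hf₁ : ∀ β, observableFunction B A₁ β = (φ β).re := fun β =>
    observableFunction_eq hB h₁ hs₁ (hv₁ β)
  have hf₂ : ∀ β, observableFunction B A₂ β = (φ β).im := fun β =>
    observableFunction_eq hB h₂ hs₂ (hv₂ β)
  refine ⟨A₁ + Complex.I • A₂, ⟨A₁, A₂, h₁, h₂, hs₁, hs₂, rfl, hf₁, hf₂⟩, ?_⟩
  rintro _ ⟨A₁', A₂', h₁', h₂', hs₁', hs₂', rfl, hf₁', hf₂'⟩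
  rw [eq_of_observableFunction_eq hB h₁' h₁ hs₁' hs₁ fun β => (hf₁' β).trans (hf₁ β).symm,
    eq_of_observableFunction_eq hB h₂' h₂ hs₂' hs₂ fun β => (hf₂' β).trans (hf₂ β).symm]

theorem isOperatorOf_operatorOf (hB : IsBooleanSector B) (φ : C(Quasipoint B, ℂ)) :
    IsOperatorOf B φ (operatorOf B φ) :=
  Classical.epsilon_spec (existsUnique_isOperatorOf hB φ).exists

/-- The projection `P_U` is the operator of the indicator function of `U`. -/
theorem operatorOf_indicatorMap (hB : IsBooleanSector B) (U : B) :
    operatorOf B ⟨fun β => (indicatorMap hB U β : ℂ),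
      Complex.continuous_ofReal.comp (indicatorMap hB U).continuous⟩ = proj U.1 := by
  refine (existsUnique_isOperatorOf hB _).unique (isOperatorOf_operatorOf hB _)
    ⟨proj U.1, 0, proj_mem_cstar U, (cstar B).zero_mem, isSelfAdjoint_proj U.1, .zero _, by simp,
      fun β => ?_, fun β => ?_⟩
  · exact observableFunction_eq hB (proj_mem_cstar U) (isSelfAdjoint_proj U.1)
      (hasValueAt_proj hB U β)
  · exact observableFunction_eq hB (cstar B).zero_mem (.zero _) (hasValueAt_zero β)

end Realisation

section Trace

variable {H : Type u} [NormedAddCommGroup H] [InnerProductSpace ℂ H]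

/-! ### The trace of a product with a density operator -/

theorem hasSum_norm_inner_sq {ι : Type*} (e : HilbertBasis ι ℂ H) (x : H) :
    HasSum (fun i => ‖⟪e i, x⟫_ℂ‖ ^ 2) (‖x‖ ^ 2) := by
  have h := Complex.hasSum_re (e.hasSum_inner_mul_inner x x)
  rw [inner_self_eq_norm_sq_to_K] at h
  convert h using 1
  · funext i
    rw [← inner_conj_symm x (e i), RCLike.conj_mul]
    norm_cast
  · norm_cast

/-- If the columns of a matrix `(⟪f j, T (e i)⟫)` are square-summable with square-summable norms,
so is the whole matrix. -/
theorem summable_norm_inner_sq {ι κ : Type*} (e : HilbertBasis ι ℂ H) (f : HilbertBasis κ ℂ H)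
    {T : H →L[ℂ] H} (hT : Summable fun i => ‖T (e i)‖ ^ 2) :
    Summable fun p : ι × κ => ‖⟪f p.2, T (e p.1)⟫_ℂ‖ ^ 2 := by
  rw [summable_prod_of_nonneg fun p => sq_nonneg _]
  refine ⟨fun i => (hasSum_norm_inner_sq f (T (e i))).summable, ?_⟩
  simpa only [(hasSum_norm_inner_sq f _).tsum_eq] using hT

variable [CompleteSpace H]

theorem HasTrace.unique {T : H →L[ℂ] H} {s t : ℂ} (hs : HasTrace T s) (ht : HasTrace T t) :
    s = t := by
  obtain ⟨w, e, -⟩ := exists_hilbertBasis ℂ H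
  exact (hs w e).unique (ht w e)

theorem trace_eq {T : H →L[ℂ] H} {t : ℂ} (h : HasTrace T t) : trace T = t := by
  have hex : ∃ t, HasTrace T t := ⟨t, h⟩
  rw [trace, dif_pos hex]
  exact hex.choose_spec.unique h

/-- Passing to the adjoint and to another basis preserves the Hilbert–Schmidt property. -/
theorem summable_norm_adjoint_sq {ι κ : Type*} (e : HilbertBasis ι ℂ H) (f : HilbertBasis κ ℂ H)
    {T : H →L[ℂ] H} (hT : Summable fun i => ‖T (e i)‖ ^ 2) :
    Summable fun j => ‖T.adjoint (f j)‖ ^ 2 := by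
  have h := (summable_norm_inner_sq e f hT).prod_symm.prod
  refine h.congr fun j => ?_
  rw [← (hasSum_norm_inner_sq e (T.adjoint (f j))).tsum_eq]
  refine tsum_congr fun i => ?_
  rw [ContinuousLinearMap.adjoint_inner_right, norm_inner_symm]
  rfl

/-- For Hilbert–Schmidt operators `S` and `T` the sum `∑ ⟪S eᵢ, T eᵢ⟫` converges; expanding in a
second basis `f` and exchanging the summations gives `∑ ⟪T† fⱼ, S† fⱼ⟫`. -/
theorem exists_hasSum_inner_of_summable {ι κ : Type*} (e : HilbertBasis ι ℂ H)
    (f : HilbertBasis κ ℂ H) {S T : H →L[ℂ] H} (hS : Summable fun i => ‖S (e i)‖ ^ 2)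
    (hT : Summable fun i => ‖T (e i)‖ ^ 2) :
    ∃ t, HasSum (fun i => ⟪S (e i), T (e i)⟫_ℂ) t ∧
      HasSum (fun j => ⟪T.adjoint (f j), S.adjoint (f j)⟫_ℂ) t := by
  let F : ι × κ → ℂ := fun p => ⟪S (e p.1), f p.2⟫_ℂ * ⟪f p.2, T (e p.1)⟫_ℂ
  have hF : Summable F := by
    refine Summable.of_norm_bounded
      ((summable_norm_inner_sq e f hS).add (summable_norm_inner_sq e f hT)) fun p => ?_
    rw [norm_mul, norm_inner_symm]
    nlinarith [sq_nonneg (‖⟪f p.2, S (e p.1)⟫_ℂ‖ - ‖⟪f p.2, T (e p.1)⟫_ℂ‖),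
      sq_nonneg ‖⟪f p.2, S (e p.1)⟫_ℂ‖, sq_nonneg ‖⟪f p.2, T (e p.1)⟫_ℂ‖]
  refine ⟨∑' p, F p,
    hF.hasSum.prod_fiberwise fun i => f.hasSum_inner_mul_inner (S (e i)) (T (e i)),
    ((Equiv.prodComm κ ι).hasSum_iff.2 hF.hasSum).prod_fiberwise fun j => ?_⟩
  refine (e.hasSum_inner_mul_inner (T.adjoint (f j)) (S.adjoint (f j))).congr_fun fun i => ?_
  change ⟪S (e i), f j⟫_ℂ * ⟪f j, T (e i)⟫_ℂ = _
  rw [ContinuousLinearMap.adjoint_inner_left, ContinuousLinearMap.adjoint_inner_right, mul_comm]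

theorem exists_isSelfAdjoint_mul_self {ρ : H →L[ℂ] H} (hρ : ρ.IsPositive) :
    ∃ S : H →L[ℂ] H, IsSelfAdjoint S ∧ S * S = ρ := by
  have h0 : 0 ≤ ρ := (ContinuousLinearMap.nonneg_iff_isPositive ρ).2 hρ
  exact ⟨CFC.sqrt ρ, (CFC.sqrt_nonneg ρ).isSelfAdjoint, CFC.sqrt_mul_sqrt_self ρ h0⟩

theorem hasSum_norm_sq_of_mul_self {ρ S : H →L[ℂ] H} (hρ : IsDensityOperator ρ)
    (hS : IsSelfAdjoint S) (hSρ : S * S = ρ) {ι : Type u} (e : HilbertBasis ι ℂ H) :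
    HasSum (fun i => ‖S (e i)‖ ^ 2) 1 := by
  have h := Complex.hasSum_re (hρ.hasTrace ι e)
  convert h using 1
  swap
  · exact Complex.one_re.symm
  funext i
  have := hS.isSymmetric (e i) (S (e i))
  simp only [ContinuousLinearMap.coe_coe] at this
  rw [← hSρ, mul_apply_eq_comp, ← this, inner_self_eq_norm_sq_to_K]
  norm_cast

/-- If `S` is a self-adjoint square root of a density operator, `S * S * A` and `S * A * S` have
the same trace, since `S` and `S * A` are Hilbert–Schmidt. -/
theorem exists_hasTrace_of_mul_self {ρ S : H →L[ℂ] H} (hρ : IsDensityOperator ρ)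
    (hS : IsSelfAdjoint S) (hSρ : S * S = ρ) (A : H →L[ℂ] H) :
    ∃ t, HasTrace (ρ * A) t ∧ HasTrace (S * A * S) t := by
  obtain ⟨w, f, -⟩ := exists_hilbertBasis ℂ H
  have hsq {κ : Type u} (e : HilbertBasis κ ℂ H) : Summable fun i => ‖S (e i)‖ ^ 2 :=
    (hasSum_norm_sq_of_mul_self hρ hS hSρ e).summable
  have hadj : (S * A).adjoint = A.adjoint * S := by
    rw [← ContinuousLinearMap.star_eq_adjoint, star_mul, hS.star_eq,
      ContinuousLinearMap.star_eq_adjoint]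
  have hsq' {κ : Type u} (e : HilbertBasis κ ℂ H) : Summable fun i => ‖(S * A) (e i)‖ ^ 2 := by
    have h : Summable fun j => ‖(S * A).adjoint (f j)‖ ^ 2 := by
      refine Summable.of_nonneg_of_le (fun _ => sq_nonneg _) (fun j => ?_)
        ((hsq f).mul_left (‖A.adjoint‖ ^ 2))
      rw [hadj, ← mul_pow]
      exact pow_le_pow_left₀ (norm_nonneg _) (A.adjoint.le_opNorm _) 2
    simpa only [ContinuousLinearMap.adjoint_adjoint] using summable_norm_adjoint_sq f e h
  -- For any two bases the sums for `S * S * A` and for `S * A * S` agree.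
  have key {ι κ : Type u} (e : HilbertBasis ι ℂ H) (e' : HilbertBasis κ ℂ H) :
      ∃ t, HasSum (fun i => ⟪e i, (ρ * A) (e i)⟫_ℂ) t ∧
        HasSum (fun j => ⟪e' j, (S * A * S) (e' j)⟫_ℂ) t := by
    obtain ⟨t, h1, h2⟩ := exists_hasSum_inner_of_summable e e' (hsq e) (hsq' e)
    refine ⟨t, h1.congr_fun fun i => ?_, h2.congr_fun fun j => ?_⟩
    · have := hS.isSymmetric (e i) ((S * A) (e i))
      simp only [ContinuousLinearMap.coe_coe] at this
      rw [this, ← hSρ]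
      rfl
    · have := hS.isSymmetric (e' j) (A (S (e' j)))
      simp only [ContinuousLinearMap.coe_coe] at this
      rw [hadj, ← ContinuousLinearMap.star_eq_adjoint S, hS.star_eq,
        mul_apply_eq_comp A.adjoint, ContinuousLinearMap.adjoint_inner_left, this]
      rfl
  obtain ⟨t, h1, h2⟩ := key f f
  refine ⟨t, fun ι e => ?_, fun ι e => ?_⟩
  · obtain ⟨s, hs1, hs2⟩ := key e f
    exact hs2.unique h2 ▸ hs1
  · obtain ⟨s, hs1, hs2⟩ := key f e
    exact hs1.unique h1 ▸ hs2

theorem IsDensityOperator.exists_hasTrace {ρ : H →L[ℂ] H} (hρ : IsDensityOperator ρ)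
    (A : H →L[ℂ] H) : ∃ t, HasTrace (ρ * A) t := by
  obtain ⟨S, hS, hSρ⟩ := exists_isSelfAdjoint_mul_self hρ.isPositive
  obtain ⟨t, ht, -⟩ := exists_hasTrace_of_mul_self hρ hS hSρ A
  exact ⟨t, ht⟩

/-- A density operator that gives probability zero to a subspace vanishes on it. -/
theorem IsDensityOperator.mul_proj_eq_zero {ρ : H →L[ℂ] H} (hρ : IsDensityOperator ρ)
    {U : ClosedSubmodule ℂ H} (h : HasTrace (ρ * proj U) 0) : ρ * proj U = 0 := by
  obtain ⟨S, hS, hSρ⟩ := exists_isSelfAdjoint_mul_self hρ.isPositive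
  obtain ⟨t, ht, ht'⟩ := exists_hasTrace_of_mul_self hρ hS hSρ (proj U)
  obtain rfl : t = 0 := ht.unique h
  obtain ⟨w, f, -⟩ := exists_hilbertBasis ℂ H
  -- The diagonal entries of `S * P_U * S` are the numbers `‖P_U (S fⱼ)‖ ^ 2`.
  have hsum : HasSum (fun j => ‖proj U (S (f j))‖ ^ 2) 0 := by
    rw [← Complex.zero_re]
    refine (Complex.hasSum_re (ht' w f)).congr_fun fun j => ?_
    have e1 := hS.isSymmetric (f j) (proj U (S (f j)))
    have e2 := (isSelfAdjoint_proj U).isSymmetric (S (f j)) (proj U (S (f j)))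
    have e3 : proj U (proj U (S (f j))) = proj U (S (f j)) :=
      proj_apply_eq_self_iff.2 (proj_apply_mem U _)
    simp only [ContinuousLinearMap.coe_coe] at e1 e2
    rw [e3, inner_self_eq_norm_sq_to_K] at e2
    rw [mul_apply_eq_comp, mul_apply_eq_comp, ← e1, ← e2]
    norm_cast
  have hzero : ∀ j, proj U (S (f j)) = 0 := fun j => by
    have := congrFun ((hasSum_zero_iff_of_nonneg fun j => sq_nonneg _).1 hsum) j
    simpa using this
  have hSP : S * proj U = 0 := by
    ext y
    have hy := hasSum_norm_inner_sq f ((S * proj U) y)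
    have hcoef : ∀ j, ⟪f j, (S * proj U) y⟫_ℂ = 0 := fun j => by
      have e1 := hS.isSymmetric (f j) (proj U y)
      have e2 := (isSelfAdjoint_proj U).isSymmetric (S (f j)) y
      simp only [ContinuousLinearMap.coe_coe] at e1 e2
      rw [mul_apply_eq_comp, ← e1, ← e2, hzero, inner_zero_left]
    simp only [hcoef, norm_zero, ne_eq, OfNat.ofNat_ne_zero, not_false_eq_true, zero_pow] at hy
    simpa using hy.unique hasSum_zero
  rw [← hSρ, mul_assoc, hSP, mul_zero]

theorem line_proj_apply {x : H} (hx : ‖x‖ = 1) (z : H) : proj (line x) z = ⟪x, z⟫_ℂ • x :=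
  Submodule.starProjection_unit_singleton ℂ hx z

/-- The state given by a unit eigenvector of `A` has the eigenvalue as its expectation of `A`. -/
theorem hasTrace_proj_line_mul {A : H →L[ℂ] H} {x : H} (hx : ‖x‖ = 1) {c : ℂ}
    (h : A x = c • x) : HasTrace (proj (line x) * A) c := fun ι e => by
  have hsum := e.hasSum_inner_mul_inner (A.adjoint x) x
  rw [ContinuousLinearMap.adjoint_inner_left, h, inner_smul_right,
    inner_self_eq_norm_sq_to_K, hx] at hsum
  simp only [RCLike.ofReal_one, one_pow, mul_one] at hsum
  refine hsum.congr_fun fun i => ?_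
  rw [mul_apply_eq_comp, line_proj_apply hx, inner_smul_right,
    ContinuousLinearMap.adjoint_inner_left]

end Trace

section PureStates

variable {H : Type u} [NormedAddCommGroup H] [InnerProductSpace ℂ H] [CompleteSpace H]
  {B : Sublattice (ClosedSubmodule ℂ H)} {ρ : H →L[ℂ] H}

/-! ### Point measures and vector states -/

/-- If the measure of `ρ` is the point measure at `β`, the range of `ρ` lies in every element
of `β`, because the complementary indicator functions have integral zero. -/
theorem apply_mem_of_stateMeasure_eq (hB : IsBooleanSector B) (hρ : IsDensityOperator ρ)
    {β : Quasipoint B} (h : stateMeasure B ρ = pointMeasure β) {U : B} (hU : U ∈ β.1) (y : H) :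
    ρ y ∈ (U : ClosedSubmodule ℂ H) := by
  have hU' : hB.compl U ∉ β.1 := fun h' => hB.compl_mem_iff.1 h' hU
  have hval := congrFun h ⟨fun β => (indicatorMap hB (hB.compl U) β : ℂ),
    Complex.continuous_ofReal.comp (indicatorMap hB (hB.compl U)).continuous⟩
  rw [stateMeasure, operatorOf_indicatorMap] at hval
  have hval' : trace (ρ * proj (U : ClosedSubmodule ℂ H)ᗮ) = 0 := by
    refine hval.trans ?_
    change ((indicatorMap hB (hB.compl U) β : ℝ) : ℂ) = 0
    rw [indicatorMap_of_notMem hB hU', Complex.ofReal_zero]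
  obtain ⟨t, ht⟩ := hρ.exists_hasTrace (proj (U : ClosedSubmodule ℂ H)ᗮ)
  obtain rfl : t = 0 := (trace_eq ht).symm.trans hval'
  have hzero := hρ.mul_proj_eq_zero ht
  rw [proj_orthogonal, mul_sub, mul_one, sub_eq_zero] at hzero
  have hstar := congrArg star hzero
  rw [star_mul, hρ.isPositive.isSelfAdjoint.star_eq, (isSelfAdjoint_proj _).star_eq] at hstar
  rw [hstar]
  exact proj_apply_mem _ _

omit [CompleteSpace H] in
theorem mem_line_iff {x z : H} : z ∈ line x ↔ ∃ c : ℂ, c • x = z :=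
  Submodule.mem_span_singleton

omit [CompleteSpace H] in
theorem line_le_iff {x : H} {U : ClosedSubmodule ℂ H} : line x ≤ U ↔ x ∈ U :=
  Submodule.span_singleton_le_iff_mem x U.toSubmodule

/-- A line contained in all elements of a quasipoint belongs to the sector and to the quasipoint,
which is then atomic: each projection of the sector either fixes or kills the line. -/
theorem line_mem_of_forall_mem (hB : IsBooleanSector B) {β : Quasipoint B} {x : H} (hx : x ≠ 0)
    (h : ∀ U ∈ β.1, x ∈ (U : ClosedSubmodule ℂ H)) :
    ∃ hl : line x ∈ B, (⟨line x, hl⟩ : B) ∈ β.1 ∧ β.1 = atomicQuasipoint B x := by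
  have hl : line x ∈ B := by
    refine hB.mem_of_forall_invariant fun V hV z hz => ?_
    lift V to B using hV
    obtain ⟨c, rfl⟩ := mem_line_iff.1 hz
    rw [map_smul]
    by_cases hVβ : V ∈ β.1
    · rwa [proj_apply_eq_self_iff.2 (h V hVβ)]
    · rw [proj_apply_eq_zero_iff.2 (h _ (hB.compl_mem_iff.2 hVβ)), smul_zero]
      exact zero_mem (line x)
  have hmem : (⟨line x, hl⟩ : B) ∈ β.1 := by
    by_contra hn
    have h0 := (ClosedSubmodule.mem_orthogonal _ _).1 (h _ (hB.compl_mem_iff.2 hn)) x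
      (line_le_iff.1 le_rfl)
    exact hx (inner_self_eq_zero.1 h0)
  refine ⟨hl, hmem, Set.ext fun U => ⟨fun hU => line_le_iff.2 (h U hU), fun hU => ?_⟩⟩
  exact Quasipoint.mem_of_le hmem hU

/-- A density operator whose range lies in a line is the projection onto the line. -/
theorem IsDensityOperator.eq_proj_line (hρ : IsDensityOperator ρ) {x : H} (hx : ‖x‖ = 1)
    (h : ∀ y, ρ y ∈ line x) : ρ = proj (line x) := by
  have h1 : proj (line x) * ρ = ρ := by
    ext y
    exact proj_apply_eq_self_iff.2 (h y)
  have h2 := congrArg star h1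
  rw [star_mul, hρ.isPositive.isSelfAdjoint.star_eq, (isSelfAdjoint_proj _).star_eq] at h2
  obtain ⟨c, hc⟩ := mem_line_iff.1 (h x)
  have htr := hasTrace_proj_line_mul hx hc.symm
  rw [h1] at htr
  obtain rfl := htr.unique hρ.hasTrace
  ext y
  rw [← h2, mul_apply_eq_comp, line_proj_apply hx, map_smul, ← hc, one_smul]

end PureStates

end QuantumLattice

theorem mainTheorem4 {H : Type u} [NormedAddCommGroup H] [InnerProductSpace ℂ H] [CompleteSpace H]
    [TopologicalSpace.SeparableSpace H]
    (B : Sublattice (ClosedSubmodule ℂ H)) (hB : QuantumLattice.IsBooleanSector B)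
    (ρ : H →L[ℂ] H) (hρ : QuantumLattice.IsDensityOperator ρ) :
    (∀ φ : C(QuantumLattice.Quasipoint B, ℂ),
      (∃! A : H →L[ℂ] H, QuantumLattice.IsOperatorOf B φ A) ∧
        ∃ t : ℂ, QuantumLattice.HasTrace (ρ * QuantumLattice.operatorOf B φ) t) ∧
    ∀ β₀ : QuantumLattice.Quasipoint B,
      QuantumLattice.stateMeasure B ρ = QuantumLattice.pointMeasure β₀ ↔
        ∃ x : H, ‖x‖ = 1 ∧ QuantumLattice.line x ∈ B ∧
          β₀.1 = QuantumLattice.atomicQuasipoint B x ∧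
          ρ = QuantumLattice.proj (QuantumLattice.line x) := by
  open QuantumLattice in
  refine ⟨fun φ => ⟨existsUnique_isOperatorOf hB φ, hρ.exists_hasTrace _⟩,
    fun β₀ => ⟨fun h => ?_, ?_⟩⟩
  · obtain ⟨y, hy⟩ : ∃ y, ρ y ≠ 0 := by
      by_contra! h0
      obtain rfl : ρ = 0 := ContinuousLinearMap.ext h0
      have h0' : HasTrace (0 : H →L[ℂ] H) 0 := fun ι e => by simp
      exact one_ne_zero (hρ.hasTrace.unique h0')
    have hx : ‖((‖ρ y‖⁻¹ : ℝ) : ℂ) • ρ y‖ = 1 := by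
      rw [norm_smul, Complex.norm_real, norm_inv, norm_norm,
        inv_mul_cancel₀ (norm_ne_zero_iff.2 hy)]
    obtain ⟨hl, hmem, hβ⟩ := line_mem_of_forall_mem hB (norm_ne_zero_iff.1 (hx ▸ one_ne_zero))
      fun U hU => U.1.smul_mem _ (apply_mem_of_stateMeasure_eq hB hρ h hU y)
    exact ⟨_, hx, hl, hβ,
      hρ.eq_proj_line hx fun z => apply_mem_of_stateMeasure_eq hB hρ h hmem z⟩
  · rintro ⟨x, hx, -, hβ, rfl⟩
    funext φ
    refine trace_eq (hasTrace_proj_line_mul hx ?_)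
    refine ((isOperatorOf_operatorOf hB φ).hasValueAt hB β₀).apply_eq fun U hU => ?_
    rw [hβ] at hU
    exact line_le_iff.1 hU
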